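/- Let $\mathbb{D}=\{z\in\mathbb{C}:|z|<1\}$. A finite Blaschke product is a function of the form $$B(z)=e^{i\alpha}\prod_{k=1}^{n}\frac{z_k-z}{1-\overline{z_k}\,z},\qquad \alpha\in\mathbb{R},\quad z_1,\dots,z_n\in\mathbb{D}$$ (the $z_k$ need not be distinct). A set $A\subseteq\mathbb{D}$ is hyperbolically convex if for all $z_1,z_2\in A$ and all $t\in[0,1]$ $$\frac{z_1-\frac{z_1-z_2}{1-\overline{z_1}z_2}\,t}{1-\overline{z_1}\,\frac{z_1-z_2}{1-\overline{z_1}z_2}\,t}\in A,$$ that is, if $A$ contains the hyperbolic segment between any two of its points. The hyperbolic convex hull of a set $S\subseteq\mathbb{D}$ is the intersection of all hyperbolically convex sets that contain $S$. Theorem. If $B$ is a nonconstant finite Blaschke product, then every zero of $B'$ in $\mathbb{D}$ belongs to the hyperbolic convex hull of the set of zeros of $B$. -/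

import Mathlib

open Set

/-- The finite Blaschke product
`z ↦ e^{iα} ∏ k, (a k - z) / (1 - conj (a k) * z)` with parameters `α` and `a 0, …, a (n-1)`. -/
noncomputable def blaschkeProduct {n : ℕ} (α : ℝ) (a : Fin n → ℂ) (z : ℂ) : ℂ :=
  Complex.exp (Complex.I * α) *
    ∏ k : Fin n, (a k - z) / (1 - (starRingEnd ℂ) (a k) * z)

/-- `B` is a finite Blaschke product on the open unit disk: a unimodular constant times a finite
product of disk automorphisms (repetitions and the empty product are allowed). The values of `B`
outside the open unit disk are irrelevant. -/
def IsFiniteBlaschkeProduct (B : ℂ → ℂ) : Prop :=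
  ∃ (n : ℕ) (α : ℝ) (a : Fin n → ℂ), (∀ k, a k ∈ Metric.ball (0 : ℂ) 1) ∧
    EqOn B (blaschkeProduct α a) (Metric.ball (0 : ℂ) 1)

/-- The point with parameter `t` on the hyperbolic segment from `z₁` (at `t = 0`) to `z₂`
(at `t = 1`) in the unit disk. -/
noncomputable def hyperbolicSegmentPoint (z₁ z₂ : ℂ) (t : ℝ) : ℂ :=
  (z₁ - (z₁ - z₂) / (1 - (starRingEnd ℂ) z₁ * z₂) * t) /
    (1 - (starRingEnd ℂ) z₁ * ((z₁ - z₂) / (1 - (starRingEnd ℂ) z₁ * z₂)) * t)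

/-- A subset of the open unit disk is hyperbolically convex if it contains the hyperbolic segment
between any two of its points. -/
def IsHyperbolicallyConvex (A : Set ℂ) : Prop :=
  A ⊆ Metric.ball (0 : ℂ) 1 ∧
    ∀ z₁ ∈ A, ∀ z₂ ∈ A, ∀ t ∈ Icc (0 : ℝ) 1, hyperbolicSegmentPoint z₁ z₂ t ∈ A

/-- The hyperbolic convex hull of a subset `S` of the open unit disk: the intersection of all
hyperbolically convex sets that contain `S`. -/
def hyperbolicConvexHull (S : Set ℂ) : Set ℂ :=
  ⋂₀ {A : Set ℂ | IsHyperbolicallyConvex A ∧ S ⊆ A}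

/-!
The map `κ z = 2 z / (1 + |z|²)` from the Poincaré disk to the Klein disk is injective on the unit
disk and straightens hyperbolic segments, so it sends every hyperbolically convex set to a convex
set (`convex_image_kleinMap`).

If `B w ≠ 0 = B' w`, then the logarithmic derivative of `B` vanishes at `w`, that is,
`∑ (1 - |aₖ|²) / ((aₖ - w) (1 - āₖ w)) = 0`. Conjugating, and writing `1 / conj x = x / |x|²`, gives
`∑ cₖ (aₖ - w) (1 - āₖ w) = 0` with all `cₖ > 0`. Now
`(a - w) (1 - ā w) = a + ā w² - w (1 + |a|²)` equals
`(1 + |a|²) / 2 * (κ a + conj (κ a) w² - 2 w)`, so a weighted mean `K` of the points `κ aₖ` solves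
`K + K̄ w² = 2 w`. As `|w| < 1`, the only solution of this equation is `κ w`
(`eq_kleinMap_of_add_conj_mul_sq`). Hence `κ w` lies in the convex set `κ '' A` for each
hyperbolically convex `A` that contains the zeros, and injectivity of `κ` gives `w ∈ A`.
-/

/-- The map `z ↦ 2 z / (1 + |z|²)` from the Poincaré model to the Klein model of the hyperbolic
plane, both realised on the unit disk. -/
noncomputable def kleinMap (z : ℂ) : ℂ := 2 * z / (1 + Complex.normSq z : ℝ)

lemma normSq_lt_one {z : ℂ} (hz : z ∈ Metric.ball (0 : ℂ) 1) : Complex.normSq z < 1 := by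
  rw [mem_ball_zero_iff] at hz
  rw [Complex.normSq_eq_norm_sq]
  nlinarith [norm_nonneg z]

lemma one_add_normSq_ne_zero (z : ℂ) : ((1 + Complex.normSq z : ℝ) : ℂ) ≠ 0 := by
  have := Complex.normSq_nonneg z
  exact_mod_cast (by positivity : (1 + Complex.normSq z : ℝ) ≠ 0)

lemma one_sub_conj_mul_ne_zero {a z : ℂ} (ha : ‖a‖ < 1) (hz : ‖z‖ ≤ 1) :
    1 - (starRingEnd ℂ) a * z ≠ 0 := by
  intro h
  have h1 : ‖(starRingEnd ℂ) a * z‖ = 1 := by rw [← sub_eq_zero.mp h, norm_one]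
  rw [norm_mul, RCLike.norm_conj] at h1
  nlinarith [norm_nonneg a, norm_nonneg z]

lemma kleinMap_injOn : InjOn kleinMap (Metric.ball (0 : ℂ) 1) := by
  intro z hz w hw h
  rw [mem_ball_zero_iff] at hz hw
  have hz' := one_add_normSq_ne_zero z
  have hw' := one_add_normSq_ne_zero w
  unfold kleinMap at h
  rw [div_eq_div_iff hz' hw'] at h
  have hn := congrArg norm h
  simp only [norm_mul, Complex.norm_real, Real.norm_eq_abs, Complex.norm_ofNat] at hn
  rw [abs_of_nonneg (by have := Complex.normSq_nonneg w; positivity),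
    abs_of_nonneg (by have := Complex.normSq_nonneg z; positivity),
    Complex.normSq_eq_norm_sq, Complex.normSq_eq_norm_sq] at hn
  have hfac : (‖z‖ - ‖w‖) * (1 - ‖z‖ * ‖w‖) = 0 := by linarith
  have hlt : ‖z‖ * ‖w‖ < 1 := by nlinarith [norm_nonneg z, norm_nonneg w]
  have heq : ‖z‖ = ‖w‖ := by
    rcases mul_eq_zero.mp hfac with h | h <;> linarith
  rw [Complex.normSq_eq_norm_sq, Complex.normSq_eq_norm_sq, heq] at h
  rw [Complex.normSq_eq_norm_sq] at hw'
  exact mul_left_cancel₀ two_ne_zero (mul_right_cancel₀ hw' h)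

/-- The real-linear map `K ↦ K + K̄ w²` is injective for `|w| < 1`, and `kleinMap w` is the preimage
of `2 w`. -/
lemma eq_kleinMap_of_add_conj_mul_sq {w K : ℂ} (hw : ‖w‖ < 1)
    (h : K + (starRingEnd ℂ) K * w ^ 2 = 2 * w) : K = kleinMap w := by
  have hw' := one_add_normSq_ne_zero w
  have hκ : kleinMap w + (starRingEnd ℂ) (kleinMap w) * w ^ 2 = 2 * w := by
    unfold kleinMap
    simp only [map_div₀, map_mul, Complex.conj_ofReal, map_ofNat]
    field_simp
    push_cast
    rw [Complex.normSq_eq_conj_mul_self]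
    ring
  have hδ : K - kleinMap w = -((starRingEnd ℂ) (K - kleinMap w) * w ^ 2) := by
    rw [map_sub]
    linear_combination h - hκ
  have hn := congrArg norm hδ
  rw [norm_neg, norm_mul, RCLike.norm_conj, norm_pow] at hn
  have hsq : ‖w‖ ^ 2 < 1 := by nlinarith [norm_nonneg w]
  have : ‖K - kleinMap w‖ = 0 := by nlinarith [norm_nonneg (K - kleinMap w)]
  exact sub_eq_zero.mp (norm_eq_zero.mp this)

/-! ### Hyperbolic segments in the Klein model -/

lemma normSq_sub_div_one_sub_conj_mul_lt_one {z₁ z₂ : ℂ} (h₁ : z₁ ∈ Metric.ball (0 : ℂ) 1)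
    (h₂ : z₂ ∈ Metric.ball (0 : ℂ) 1) :
    Complex.normSq ((z₁ - z₂) / (1 - (starRingEnd ℂ) z₁ * z₂)) < 1 := by
  have hne := one_sub_conj_mul_ne_zero (mem_ball_zero_iff.mp h₁) (mem_ball_zero_iff.mp h₂).le
  rw [Complex.normSq_div, div_lt_one (Complex.normSq_pos.mpr hne)]
  have h1 := normSq_lt_one h₁
  have h2 := normSq_lt_one h₂
  have hprod := mul_pos (sub_pos.mpr h1) (sub_pos.mpr h2)
  simp only [Complex.normSq_apply, Complex.sub_re, Complex.sub_im, Complex.mul_re, Complex.mul_im,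
    Complex.conj_re, Complex.conj_im, Complex.one_re, Complex.one_im] at hprod ⊢
  nlinarith

/-- If `z₂` is the image of `d` under the involution `u ↦ (z₁ - u) / (1 - z̄₁ u)`, then the image `p`
of `d t` satisfies `|1 - z̄₁ d t|² (p, 1 + |p|²) =
(1 - t) (1 - |d|² t) (z₁, 1 + |z₁|²) + t |1 - z̄₁ d|² (z₂, 1 + |z₂|²)`. Dividing
the first coordinate by the second writes `kleinMap p` as a weighted mean of `kleinMap z₁` and
`kleinMap z₂`. -/
lemma kleinMap_mobius_mul_weights {z₁ z₂ d : ℂ} {t : ℝ}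
    (ht : 1 - (starRingEnd ℂ) z₁ * d * t ≠ 0) (hd : 1 - (starRingEnd ℂ) z₁ * d ≠ 0)
    (hz₂ : z₂ = (z₁ - d) / (1 - (starRingEnd ℂ) z₁ * d)) :
    kleinMap ((z₁ - d * t) / (1 - (starRingEnd ℂ) z₁ * d * t)) *
      (((1 - t) * (1 - Complex.normSq d * t) * (1 + Complex.normSq z₁) +
        t * Complex.normSq (1 - (starRingEnd ℂ) z₁ * d) * (1 + Complex.normSq z₂) : ℝ) : ℂ) =
    (((1 - t) * (1 - Complex.normSq d * t) * (1 + Complex.normSq z₁) : ℝ) : ℂ) * kleinMap z₁ +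
      ((t * Complex.normSq (1 - (starRingEnd ℂ) z₁ * d) * (1 + Complex.normSq z₂) : ℝ) : ℂ) *
        kleinMap z₂ := by
  set p := (z₁ - d * t) / (1 - (starRingEnd ℂ) z₁ * d * t) with hp
  have hκ (z : ℂ) : ((1 + Complex.normSq z : ℝ) : ℂ) * kleinMap z = 2 * z :=
    mul_div_cancel₀ _ (one_add_normSq_ne_zero z)
  have hpm : p * (1 - (starRingEnd ℂ) z₁ * d * t) = z₁ - d * t := div_mul_cancel₀ _ ht
  have hzm : z₂ * (1 - (starRingEnd ℂ) z₁ * d) = z₁ - d := by rw [hz₂]; exact div_mul_cancel₀ _ hd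
  have hpc := congrArg (starRingEnd ℂ) hpm
  have hzc := congrArg (starRingEnd ℂ) hzm
  simp only [map_mul, map_sub, map_one, Complex.conj_conj, Complex.conj_ofReal] at hpc hzc
  have hW : (((1 - t) * (1 - Complex.normSq d * t) * (1 + Complex.normSq z₁) +
        t * Complex.normSq (1 - (starRingEnd ℂ) z₁ * d) * (1 + Complex.normSq z₂) : ℝ) : ℂ) =
      Complex.normSq (1 - (starRingEnd ℂ) z₁ * d * t) * ((1 + Complex.normSq p : ℝ) : ℂ) := by
    push_cast
    simp only [Complex.normSq_eq_conj_mul_self, map_mul, map_sub, map_one, Complex.conj_conj,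
      Complex.conj_ofReal]
    have e1 : (starRingEnd ℂ) z₂ * (1 - z₁ * (starRingEnd ℂ) d) *
        (z₂ * (1 - (starRingEnd ℂ) z₁ * d)) =
        ((starRingEnd ℂ) z₁ - (starRingEnd ℂ) d) * (z₁ - d) := by rw [hzc, hzm]
    have e2 : (starRingEnd ℂ) p * (1 - z₁ * (starRingEnd ℂ) d * t) *
        (p * (1 - (starRingEnd ℂ) z₁ * d * t)) =
        ((starRingEnd ℂ) z₁ - (starRingEnd ℂ) d * t) * (z₁ - d * t) := by rw [hpc, hpm]
    linear_combination (t : ℂ) * e1 - e2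
  have hN : Complex.normSq (1 - (starRingEnd ℂ) z₁ * d * t) * p =
      (((1 - t) * (1 - Complex.normSq d * t) : ℝ) : ℂ) * z₁ +
        ((t * Complex.normSq (1 - (starRingEnd ℂ) z₁ * d) : ℝ) : ℂ) * z₂ := by
    push_cast
    simp only [Complex.normSq_eq_conj_mul_self, map_mul, map_sub, map_one, Complex.conj_conj,
      Complex.conj_ofReal]
    linear_combination (1 - z₁ * (starRingEnd ℂ) d * t) * hpm -
      (t : ℂ) * (1 - z₁ * (starRingEnd ℂ) d) * hzm
  rw [hW]
  have h1 := hκ z₁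
  have h2 := hκ z₂
  have h3 := hκ p
  push_cast at h1 h2 h3 hN ⊢
  linear_combination (Complex.normSq (1 - (starRingEnd ℂ) z₁ * d * t) : ℂ) * h3 + 2 * hN -
    ((1 - t) * (1 - Complex.normSq d * t) : ℂ) * h1 -
    (t * Complex.normSq (1 - (starRingEnd ℂ) z₁ * d) : ℂ) * h2

lemma convex_image_kleinMap {A : Set ℂ} (hA : IsHyperbolicallyConvex A) :
    Convex ℝ (kleinMap '' A) := by
  rintro _ ⟨z₁, h₁, rfl⟩ _ ⟨z₂, h₂, rfl⟩ r s hr hs hrs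
  have hb₁ := hA.1 h₁
  have hb₂ := hA.1 h₂
  have hm := one_sub_conj_mul_ne_zero (mem_ball_zero_iff.mp hb₁) (mem_ball_zero_iff.mp hb₂).le
  set d := (z₁ - z₂) / (1 - (starRingEnd ℂ) z₁ * z₂) with hd
  have hd1 : Complex.normSq d < 1 := normSq_sub_div_one_sub_conj_mul_lt_one hb₁ hb₂
  have hdn : ‖d‖ < 1 := by
    rw [Complex.normSq_eq_norm_sq] at hd1
    nlinarith [norm_nonneg d]
  have hne (t : ℝ) (ht : t ∈ Icc (0 : ℝ) 1) : 1 - (starRingEnd ℂ) z₁ * d * t ≠ 0 := by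
    rw [mul_assoc]
    refine one_sub_conj_mul_ne_zero (mem_ball_zero_iff.mp hb₁) ?_
    rw [norm_mul, Complex.norm_real, Real.norm_of_nonneg ht.1]
    exact mul_le_one₀ hdn.le ht.1 ht.2
  have hne1 : 1 - (starRingEnd ℂ) z₁ * d ≠ 0 := by
    simpa using hne 1 ⟨zero_le_one, le_rfl⟩
  have hz₂ : z₂ = (z₁ - d) / (1 - (starRingEnd ℂ) z₁ * d) := by
    have hdm : d * (1 - (starRingEnd ℂ) z₁ * z₂) = z₁ - z₂ := div_mul_cancel₀ _ hm
    rw [eq_div_iff hne1]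
    linear_combination hdm
  set E := Complex.normSq (1 - (starRingEnd ℂ) z₁ * d)
  have hE : 0 < E := Complex.normSq_pos.mpr hne1
  have hq₁ : 0 < 1 + Complex.normSq z₁ := by have := Complex.normSq_nonneg z₁; positivity
  have hq₂ : 0 < 1 + Complex.normSq z₂ := by have := Complex.normSq_nonneg z₂; positivity
  -- The parameter `t` for which the two weights are in the ratio `r : s`.
  obtain ⟨t, ht, hgt⟩ : ∃ t ∈ Icc (0 : ℝ) 1, r * (t * E * (1 + Complex.normSq z₂)) -
      s * ((1 - t) * (1 - Complex.normSq d * t) * (1 + Complex.normSq z₁)) = 0 := by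
    refine intermediate_value_Icc zero_le_one (f := fun t : ℝ ↦
      r * (t * E * (1 + Complex.normSq z₂)) -
      s * ((1 - t) * (1 - Complex.normSq d * t) * (1 + Complex.normSq z₁)))
      (by fun_prop) ⟨?_, ?_⟩
    · have : 0 ≤ s * (1 + Complex.normSq z₁) := by positivity
      simpa using this
    · have : 0 ≤ r * (E * (1 + Complex.normSq z₂)) := by positivity
      simpa using this
  refine ⟨hyperbolicSegmentPoint z₁ z₂ t, hA.2 z₁ h₁ z₂ h₂ t ht, ?_⟩
  have key := kleinMap_mobius_mul_weights (hne t ht) hne1 hz₂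
  change kleinMap ((z₁ - d * t) / (1 - (starRingEnd ℂ) z₁ * d * t)) = _
  set u := (1 - t) * (1 - Complex.normSq d * t) * (1 + Complex.normSq z₁) with hu
  set v := t * E * (1 + Complex.normSq z₂) with hv
  have hdt : 0 < 1 - Complex.normSq d * t := by
    nlinarith [ht.1, ht.2, Complex.normSq_nonneg d]
  have huv : 0 < u + v := by
    rcases ht.2.lt_or_eq with h | h
    · have hu0 : 0 < u := mul_pos (mul_pos (sub_pos.mpr h) hdt) hq₁
      have hv0 : 0 ≤ v := mul_nonneg (mul_nonneg ht.1 hE.le) hq₂.le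
      linarith
    · rw [hu, hv, h]
      simpa using mul_pos hE hq₂
  have hru : r * (u + v) = u := by
    linear_combination hgt + u * hrs
  have hsv : s * (u + v) = v := by
    linear_combination -hgt + v * hrs
  have huv' : ((u + v : ℝ) : ℂ) ≠ 0 := by exact_mod_cast huv.ne'
  apply mul_right_cancel₀ huv'
  rw [key, Complex.real_smul, Complex.real_smul]
  have hru' : (r : ℂ) * ((u + v : ℝ) : ℂ) = u := by exact_mod_cast hru
  have hsv' : (s : ℂ) * ((u + v : ℝ) : ℂ) = v := by exact_mod_cast hsv
  linear_combination -kleinMap z₁ * hru' - kleinMap z₂ * hsv'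

/-! ### Critical points of a Blaschke product -/

lemma logDeriv_blaschkeProduct {n : ℕ} (α : ℝ) {a : Fin n → ℂ} {w : ℂ} (hw : ∀ k, a k - w ≠ 0)
    (hw' : ∀ k, 1 - (starRingEnd ℂ) (a k) * w ≠ 0) :
    logDeriv (blaschkeProduct α a) w =
      -∑ k, ((1 - Complex.normSq (a k) : ℝ) : ℂ) /
        ((a k - w) * (1 - (starRingEnd ℂ) (a k) * w)) := by
  have hd (k : Fin n) : HasDerivAt (fun z ↦ (a k - z) / (1 - (starRingEnd ℂ) (a k) * z))
      ((-1 * (1 - (starRingEnd ℂ) (a k) * w) - (a k - w) * -((starRingEnd ℂ) (a k) * 1)) /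
        (1 - (starRingEnd ℂ) (a k) * w) ^ 2) w :=
    ((hasDerivAt_id w).const_sub (a k)).div
      (((hasDerivAt_id w).const_mul ((starRingEnd ℂ) (a k))).const_sub 1) (hw' k)
  unfold blaschkeProduct
  rw [logDeriv_const_mul w _ (Complex.exp_ne_zero _),
    logDeriv_prod (f := fun k z ↦ (a k - z) / (1 - (starRingEnd ℂ) (a k) * z)) (fun k _ ↦ div_ne_zero (hw k) (hw' k))
      (fun k _ ↦ (hd k).differentiableAt),
    ← Finset.sum_neg_distrib]
  refine Finset.sum_congr rfl fun k _ ↦ ?_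
  rw [logDeriv_apply, (hd k).deriv]
  have h1 := hw k
  have h2 := hw' k
  push_cast
  rw [Complex.normSq_eq_conj_mul_self]
  field_simp
  ring

/-- At a point where `∑ (1 - |aₖ|²) / ((aₖ - w) (1 - āₖ w))` vanishes, `kleinMap w` is a weighted mean
of the points `kleinMap (a k)`. -/
lemma kleinMap_mem_of_sum_eq_zero {n : ℕ} [NeZero n] {a : Fin n → ℂ} {w : ℂ} {C : Set ℂ}
    (hC : Convex ℝ C) (haC : ∀ k, kleinMap (a k) ∈ C)
    (ha : ∀ k, a k ∈ Metric.ball (0 : ℂ) 1) (hwb : w ∈ Metric.ball (0 : ℂ) 1)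
    (hw : ∀ k, a k - w ≠ 0)
    (hsum : ∑ k, ((1 - Complex.normSq (a k) : ℝ) : ℂ) /
        ((a k - w) * (1 - (starRingEnd ℂ) (a k) * w)) = 0) :
    kleinMap w ∈ C := by
  set x : Fin n → ℂ := fun k ↦ (a k - w) * (1 - (starRingEnd ℂ) (a k) * w) with hx
  have hx0 (k : Fin n) : x k ≠ 0 := mul_ne_zero (hw k)
    (one_sub_conj_mul_ne_zero (mem_ball_zero_iff.mp (ha k)) (mem_ball_zero_iff.mp hwb).le)
  set c : Fin n → ℝ := fun k ↦
    (1 - Complex.normSq (a k)) / Complex.normSq (x k) * ((1 + Complex.normSq (a k)) / 2) with hc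
  have hc0 (k : Fin n) : 0 < c k := by
    have h1 := sub_pos.mpr (normSq_lt_one (ha k))
    have h2 := Complex.normSq_pos.mpr (hx0 k)
    have h3 := Complex.normSq_nonneg (a k)
    positivity
  have hW : 0 < ∑ k, c k := Finset.sum_pos (fun k _ ↦ hc0 k) Finset.univ_nonempty
  have hterm (k : Fin n) :
      (c k : ℂ) * (kleinMap (a k) + (starRingEnd ℂ) (kleinMap (a k)) * w ^ 2 - 2 * w) =
      (starRingEnd ℂ) (((1 - Complex.normSq (a k) : ℝ) : ℂ) / x k) := by
    have hq := one_add_normSq_ne_zero (a k)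
    have hxk : (starRingEnd ℂ) (x k) ≠ 0 := (map_ne_zero _).mpr (hx0 k)
    have hx' := hx0 k
    have hlin : ((1 + Complex.normSq (a k) : ℝ) : ℂ) *
        (kleinMap (a k) + (starRingEnd ℂ) (kleinMap (a k)) * w ^ 2 - 2 * w) = 2 * x k := by
      simp only [kleinMap, map_div₀, map_mul, Complex.conj_ofReal, map_ofNat, hx]
      field_simp
      push_cast
      rw [Complex.normSq_eq_conj_mul_self]
      ring
    have hcc : (c k : ℂ) = ((1 - Complex.normSq (a k) : ℝ) : ℂ) /
        ((starRingEnd ℂ) (x k) * x k) * (((1 + Complex.normSq (a k) : ℝ) : ℂ) / 2) := by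
      rw [← Complex.normSq_eq_conj_mul_self]
      simp only [hc]
      push_cast
      ring
    rw [hcc, map_div₀, Complex.conj_ofReal, mul_assoc, div_mul_eq_mul_div _ (2 : ℂ), hlin]
    field_simp
  have hsum' : ∑ k, (c k : ℂ) *
      (kleinMap (a k) + (starRingEnd ℂ) (kleinMap (a k)) * w ^ 2 - 2 * w) = 0 := by
    rw [Finset.sum_congr rfl fun k _ ↦ hterm k, ← map_sum, hsum, map_zero]
  have hmem := hC.centerMass_mem (t := Finset.univ) (fun k _ ↦ (hc0 k).le) hW (fun k _ ↦ haC k)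
  convert hmem using 1
  refine (eq_kleinMap_of_add_conj_mul_sq (mem_ball_zero_iff.mp hwb) ?_).symm
  have hW' : (∑ k, (c k : ℂ)) ≠ 0 := by exact_mod_cast hW.ne'
  rw [Finset.centerMass, Complex.real_smul, map_mul, Complex.conj_ofReal, map_sum]
  simp only [Complex.real_smul, map_mul, Complex.conj_ofReal]
  push_cast
  have hsplit : ∑ k, (c k : ℂ) * kleinMap (a k) +
      (∑ k, (c k : ℂ) * (starRingEnd ℂ) (kleinMap (a k))) * w ^ 2 =
      (∑ k, (c k : ℂ)) * (2 * w) := by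
    rw [← sub_eq_zero, ← hsum', Finset.sum_mul, Finset.sum_mul, ← Finset.sum_add_distrib,
      ← Finset.sum_sub_distrib]
    exact Finset.sum_congr rfl fun k _ ↦ by ring
  rw [mul_assoc, ← mul_add, hsplit, inv_mul_cancel_left₀ hW']

theorem theoremT (B : ℂ → ℂ) (hB : IsFiniteBlaschkeProduct B)
    (hconst : ¬ ∃ c : ℂ, ∀ z ∈ Metric.ball (0 : ℂ) 1, B z = c) :
    {w : ℂ | w ∈ Metric.ball (0 : ℂ) 1 ∧ deriv B w = 0} ⊆
      hyperbolicConvexHull {z : ℂ | z ∈ Metric.ball (0 : ℂ) 1 ∧ B z = 0} := by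
  rintro w ⟨hw, hdw⟩ A ⟨hA, hS⟩
  by_cases hBw : B w = 0
  · exact hS ⟨hw, hBw⟩
  obtain ⟨n, α, a, ha, hEq⟩ := hB
  have hn : NeZero n := ⟨by
    rintro rfl
    exact hconst ⟨Complex.exp (Complex.I * α), fun z hz ↦ by simp [hEq hz, blaschkeProduct]⟩⟩
  have hzero (k : Fin n) : B (a k) = 0 := by
    rw [hEq (ha k), blaschkeProduct, Finset.prod_eq_zero (Finset.mem_univ k) (by simp), mul_zero]
  have haA (k : Fin n) : a k ∈ A := hS ⟨ha k, hzero k⟩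
  have hne (k : Fin n) : a k - w ≠ 0 := by
    intro h
    exact hBw (sub_eq_zero.mp h ▸ hzero k)
  have hlog : logDeriv (blaschkeProduct α a) w = 0 := by
    have hev : B =ᶠ[nhds w] blaschkeProduct α a :=
      hEq.eventuallyEq_of_mem (Metric.isOpen_ball.mem_nhds hw)
    rw [logDeriv_apply, ← hev.deriv_eq, hdw, zero_div]
  rw [logDeriv_blaschkeProduct α hne fun k ↦ one_sub_conj_mul_ne_zero
    (mem_ball_zero_iff.mp (ha k)) (mem_ball_zero_iff.mp hw).le, neg_eq_zero] at hlog
  obtain ⟨z, hz, hzw⟩ := kleinMap_mem_of_sum_eq_zero (convex_image_kleinMap hA)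
    (fun k ↦ mem_image_of_mem _ (haA k)) ha hw hne hlog
  exact kleinMap_injOn (hA.1 hz) hw hzw ▸ hz
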